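/- Consider the Gaussian location model $Y=\theta^*+Z$, where $Y,\theta^*,Z\in\mathbb R^{d\times m}$ and the entries of $Z$ are independent $\mathcal N(0,\sigma^2/n)$ variables ($n\ge 1$ an integer, $\sigma>0$). For $\theta\in\mathbb R^{d\times m}$ let $\theta_j\in\mathbb R^d$ be its $j$-th column. For integers $s,s_0$, and for $q\in(0,1]$, $R_q>0$, put $$\Theta^{m,d}_0(s,s_0)=\{\theta:\ \#\{j:\theta_j\ne 0\}\le s,\ \#\{i:\theta_{ij}\neq 0\}\le s_0\ \text{for all } j\},$$ $$\Theta^{m,d}_q(s,R_q)=\{\theta:\ \#\{j:\theta_j\ne 0\}\le s,\ \textstyle\sum_{i}|\theta_{ij}|^q\le R_q\ \text{for all } j\}.$$ For a parameter set $\Theta$ we say that the minimax risk $\mathcal M(\Theta)$ is at least $r$ with probability greater than $p$ if for every estimator $\hat\theta=\hat\theta(Y)$ (a measurable function of $Y$) there is $\theta^*\in\Theta$ with $\mathbb P_{\theta^*}\big(\|\hat\theta-\theta^*\|_F^2\ge r\big)>p$, where $\|\cdot\|_F$ is the Frobenius norm. **Theorem.** (a) (Case $q=0$.) There is a universal constant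 $C>0$ such that for all integers $n\ge1$, $1\le s\le m$, $1\le s_0\le d$ and all $\sigma>0$, $$\mathcal M(\Theta^{m,d}_0(s,s_0))\ \ge\ C\,\frac{\sigma^2}{n}\Big(s\log\frac{em}{s}+s s_0\log\frac{ed}{s_0}\Big)$$ with probability greater than $\tfrac12$. (b) (Case $q\in(0,1]$.) Let $\delta\in(0,1)$ and let $C_1,\kappa,\sigma_0>0$. There is a constant $C>0$, depending only on $\delta,C_1,\kappa,\sigma_0$, such that for all $q\in(0,1]$, all integers $n\ge1$, $1\le s\le m$, $d\ge1$ and all real $R_q>0$, $\sigma\ge\sigma_0$ that satisfy $$\frac{d}{R_q\,n^{q/2}}\ \ge\ C_1 d^{\delta}\qquad\text{and}\qquad R_q^{2/q}\ \ge\ \kappa\,\frac{\sigma^2}{n}\max\Big\{\log d,\ \log\frac{em}{s}\Big\},$$ one has $$\mathcal M(\Theta^{m,d}_q(s,R_q))\ \ge\ C\Big\{\frac{\sigma^2}{n}s\log\frac{em}{s}+sR_q\Big(\frac{\sigma^2}{n}\log d\Big)^{1-\frac q2}\Big\}$$ with probability greater than $\tfrac38$. -/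

import Mathlib

open MeasureTheory ProbabilityTheory

/-- Real `d × m` matrices, with the product (Borel) `σ`-algebra of `ℝ^(d × m)`. -/
abbrev Mat (d m : ℕ) : Type := Fin d → Fin m → ℝ

/-- The `j`-th column of a matrix. -/
def column {d m : ℕ} (θ : Mat d m) (j : Fin m) : Fin d → ℝ := fun i => θ i j

/-- The `ℓ₀`-ball of `ℝ^p`: vectors with at most `s₀` non-zero entries. -/
def l0Ball (p s₀ : ℕ) : Set (Fin p → ℝ) :=
  {η | (Finset.univ.filter fun i => η i ≠ 0).card ≤ s₀}

/-- The `ℓ_q`-ball of `ℝ^p` (used for `q > 0`): vectors with `∑ |η_i|^q ≤ R`. -/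
def lqBall (p : ℕ) (q R : ℝ) : Set (Fin p → ℝ) :=
  {η | ∑ i, |η i| ^ q ≤ R}

/-- Matrices with at most `s` non-zero columns, all of whose columns lie in `B`. -/
def doubleSparse (m d s : ℕ) (B : Set (Fin d → ℝ)) : Set (Mat d m) :=
  {θ | (Finset.univ.filter fun j => column θ j ≠ 0).card ≤ s ∧ ∀ j, column θ j ∈ B}

/-- The space of `(s, s₀)`-double sparse matrices (hard sparsity, `q = 0`). -/
def Theta0 (m d s s₀ : ℕ) : Set (Mat d m) :=
  doubleSparse m d s (l0Ball d s₀)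

/-- The space of `(s, R)`-double sparse matrices over the `ℓ_q`-ball (soft sparsity, `q > 0`). -/
def Thetaq (m d s : ℕ) (q R : ℝ) : Set (Mat d m) :=
  doubleSparse m d s (lqBall d q R)

/-- The squared Frobenius norm. -/
def sqFrobenius {d m : ℕ} (A : Mat d m) : ℝ :=
  ∑ i, ∑ j, A i j ^ 2

/-- The law of the noise matrix `Z`: independent entries distributed as `N(0, σ² / n)`. -/
noncomputable def noiseLaw (d m : ℕ) (σ : ℝ) (n : ℕ) : Measure (Mat d m) :=
  Measure.pi fun _ : Fin d => Measure.pi fun _ : Fin m => gaussianReal 0 (σ ^ 2 / n).toNNReal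

/-- The law of the observation `Y = θ + Z`. -/
noncomputable def observationLaw {d m : ℕ} (θ : Mat d m) (σ : ℝ) (n : ℕ) :
    Measure (Mat d m) :=
  (noiseLaw d m σ n).map fun Z => θ + Z

/-- The minimax squared Frobenius risk over `Θ` in the model `Y = θ + Z` is at least `r` with
probability greater than `p`: every estimator `est` (a measurable function of the observation)
has, at some parameter `θ ∈ Θ`, a loss of at least `r` with probability greater than `p`. -/
def MinimaxRiskAtLeast {d m : ℕ} (Θ : Set (Mat d m)) (σ : ℝ) (n : ℕ)
    (r p : ℝ) : Prop :=
  ∀ est : Mat d m → Mat d m, Measurable est →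
    ∃ θ ∈ Θ, p < (observationLaw θ σ n).real {Y | r ≤ sqFrobenius (est Y - θ)}

/-!
Both parts rest on one family of block codes. Cut (a part of) the entries of the matrix into `N`
blocks of `k` entries. A word `w` puts one non-zero entry in each block, and its letters record the
position of that entry and its amplitude, which is one of `K = 10000` equally spaced levels in
`(0, a]`. There are `Q ^ N` words, `Q = k * K`, and the matrices of two words at Hamming distance
`h` are at squared Frobenius distance at least `h * (a / K) ^ 2`.

Under the noise law `P₀`, the law `P_w` of the observation with parameter `θ_w` has a density with
second moment `exp (‖θ_w‖² / (σ² / n)) ≤ exp (N a² / (σ² / n)) =: B`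
(`hasSqDensity_observationLaw`). Let `A_w` be the event that the estimate is within squared distance
`r = N a² / (8 K²)` of `θ_w`. By Cauchy--Schwarz `P_w (A_w) ^ 2 ≤ B * P₀ (A_w)`. An observation
lies in `A_w` only for words in a common Hamming ball of radius `N / 2`, and such a ball has at most
`(2 √Q) ^ N` words (`card_hammingDist_le`), so `∑ w, P₀ (A_w) ≤ (2 √Q) ^ N`. If
`a² ≤ (σ² / n) log Q / 4` and `K` is large, then `4 * B * (2 √Q) ^ N < Q ^ N`, and some `P_w (A_w)`
is below `1 / 2` (`exists_measureReal_lt_half`, `minimaxRiskAtLeast_blockCode`). This argument needs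
neither a packing nor Fano's inequality, and the amplitude levels make it work for blocks of a
single entry, where the supports carry no information.

The two terms of the rates come from two choices of blocks: `s` blocks of column indices in the
first row (`minimaxRiskAtLeast_columns`), and `s * s₀` blocks inside the first `s` columns
(`minimaxRiskAtLeast_supports`). Since the larger of two terms is at least half of their sum,
this gives the case `q = 0`. For `q > 0` the same codes are used at amplitudes for which the
`ℓ_q`-constraint allows one, respectively about `R / b ^ q` with `b² ≍ (σ² / n) log d`, non-zero
entries per column. In all cases the probability obtained exceeds `1 / 2`.
-/

/-! ### Second moments of densities -/

/-- `ν` has a density `L` with respect to `μ` whose second moment `∫ L² dμ` is `c`; in other words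
the `χ²`-divergence of `ν` from the probability measure `μ` is `c - 1`. -/
def HasSqDensity {Ω : Type*} [MeasurableSpace Ω] (μ ν : Measure Ω) (c : ENNReal) : Prop :=
  ∃ L : Ω → ENNReal, Measurable L ∧ ν = μ.withDensity L ∧ ∫⁻ x, L x ^ 2 ∂μ = c

theorem HasSqDensity.sq_measure_le {Ω : Type*} [MeasurableSpace Ω] {μ ν : Measure Ω} {c : ENNReal}
    (h : HasSqDensity μ ν c) {A : Set Ω} (hA : MeasurableSet A) : ν A ^ 2 ≤ c * μ A := by
  obtain ⟨L, hL, rfl, rfl⟩ := h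
  have key := ENNReal.lintegral_mul_le_Lp_mul_Lq μ
    (p := 2) (q := 2) (by constructor <;> norm_num) hL.aemeasurable
    (g := A.indicator (1 : Ω → ENNReal)) (measurable_one.indicator hA).aemeasurable
  have h1 : ∫⁻ a, (L * A.indicator (1 : Ω → ENNReal)) a ∂μ = (μ.withDensity L) A := by
    rw [withDensity_apply _ hA, ← lintegral_indicator hA]
    congr 1 with x
    by_cases hx : x ∈ A <;> simp [hx]
  have h2 : ∫⁻ a, (A.indicator (1 : Ω → ENNReal) a) ^ (2 : ℝ) ∂μ = μ A := by
    rw [← lintegral_indicator_one hA]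
    congr 1 with x
    by_cases hx : x ∈ A <;> simp [hx]
  have h3 : ∀ x : ENNReal, (x ^ (1 / 2 : ℝ)) ^ 2 = x := fun x => by
    rw [← ENNReal.rpow_natCast, ← ENNReal.rpow_mul]; norm_num
  rw [h1, h2] at key
  calc (μ.withDensity L) A ^ 2
      ≤ ((∫⁻ a, L a ^ (2 : ℝ) ∂μ) ^ (1 / 2 : ℝ) * (μ A) ^ (1 / 2 : ℝ)) ^ 2 := by gcongr
    _ = _ := by rw [mul_pow, h3, h3]; simp

theorem lintegral_pi_prod {ι : Type*} [Fintype ι] {Ω : ι → Type*} [∀ i, MeasurableSpace (Ω i)]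
    (μ : ∀ i, Measure (Ω i)) [∀ i, IsProbabilityMeasure (μ i)] {f : ∀ i, Ω i → ENNReal}
    (hf : ∀ i, Measurable (f i)) :
    ∫⁻ x, ∏ i, f i (x i) ∂Measure.pi μ = ∏ i, ∫⁻ x, f i x ∂μ i := by
  have h := iIndepFun_pi (μ := μ) (X := f) (fun i => (hf i).aemeasurable)
  have h2 := lintegral_prod_eq_prod_lintegral_of_indepFun Finset.univ _ h
    (fun i => (hf i).comp (measurable_pi_apply i))
  rw [h2]
  refine Finset.prod_congr rfl fun i _ => ?_
  rw [← (measurePreserving_eval μ i).lintegral_comp (hf i)]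

/-- Second moments of densities multiply over product measures. -/
theorem HasSqDensity.pi {ι : Type*} [Fintype ι] {Ω : ι → Type*} [∀ i, MeasurableSpace (Ω i)]
    {μ ν : ∀ i, Measure (Ω i)} [∀ i, IsProbabilityMeasure (μ i)] [∀ i, IsProbabilityMeasure (ν i)]
    {c : ι → ENNReal} (h : ∀ i, HasSqDensity (μ i) (ν i) (c i)) :
    HasSqDensity (Measure.pi μ) (Measure.pi ν) (∏ i, c i) := by
  choose L hL hν hc using h
  refine ⟨fun x => ∏ i, L i (x i),
    Finset.measurable_prod _ fun i _ => (hL i).comp (measurable_pi_apply i), ?_, ?_⟩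
  · refine Measure.pi_eq fun s hs => ?_
    rw [withDensity_apply _ (MeasurableSet.univ_pi hs),
      ← lintegral_indicator (MeasurableSet.univ_pi hs)]
    have : (Set.univ.pi s).indicator (fun x => ∏ i, L i (x i))
        = fun x => ∏ i, (s i).indicator (L i) (x i) := by
      classical
      ext x
      by_cases hx : x ∈ Set.univ.pi s
      · rw [Set.indicator_of_mem hx]
        exact Finset.prod_congr rfl fun i _ =>
          (Set.indicator_of_mem (hx i (Set.mem_univ i)) _).symm
      · rw [Set.indicator_of_notMem hx]
        obtain ⟨i, hi⟩ : ∃ i, x i ∉ s i := by simpa using hx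
        exact (Finset.prod_eq_zero (Finset.mem_univ i) (Set.indicator_of_notMem hi _)).symm
    rw [this, lintegral_pi_prod μ fun i => (hL i).indicator (hs i)]
    refine Finset.prod_congr rfl fun i _ => ?_
    rw [hν i, withDensity_apply _ (hs i), lintegral_indicator (hs i)]
  · simp_rw [← Finset.prod_pow]
    rw [lintegral_pi_prod μ fun i => (hL i).pow_const 2]
    exact Finset.prod_congr rfl fun i _ => hc i

/-- The density of a shifted Gaussian is `exp ((2 t x - t²) / (2 v))`, and the second moment of it
is a value of the moment generating function. -/
theorem hasSqDensity_gaussianReal (t : ℝ) {v : NNReal} (hv : v ≠ 0) :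
    HasSqDensity (gaussianReal 0 v) (gaussianReal t v) (ENNReal.ofReal (Real.exp (t ^ 2 / v))) := by
  have hv' : (0 : ℝ) < v := by positivity
  have hm : Measurable fun x : ℝ =>
      ENNReal.ofReal (Real.exp ((2 * t * x - t ^ 2) / (2 * v))) := by fun_prop
  refine ⟨fun x => ENNReal.ofReal (Real.exp ((2 * t * x - t ^ 2) / (2 * v))), hm, ?_, ?_⟩
  · rw [gaussianReal_of_var_ne_zero _ hv, gaussianReal_of_var_ne_zero _ hv,
      ← withDensity_mul _ (measurable_gaussianPDF _ _) hm]
    congr 1 with x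
    simp only [gaussianPDF, Pi.mul_apply, gaussianPDFReal]
    rw [← ENNReal.ofReal_mul (by positivity), mul_assoc (√(2 * Real.pi * v))⁻¹, ← Real.exp_add]
    congr 3
    field_simp
    ring
  · have h1 : ∀ x : ℝ, ENNReal.ofReal (Real.exp ((2 * t * x - t ^ 2) / (2 * v))) ^ 2
        = ENNReal.ofReal (Real.exp (-t ^ 2 / v) * Real.exp (2 * t / v * x)) := fun x => by
      rw [← ENNReal.ofReal_pow (by positivity), ← Real.exp_nat_mul, ← Real.exp_add]
      congr 2
      push_cast
      field_simp
      ring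
    simp_rw [h1]
    rw [← ofReal_integral_eq_lintegral_ofReal
      ((integrable_exp_mul_gaussianReal _).const_mul _) (ae_of_all _ fun x => by positivity),
      integral_const_mul]
    have h2 := congrFun (mgf_id_gaussianReal (μ := 0) (v := v)) (2 * t / v)
    simp only [mgf, id] at h2
    rw [h2, ← Real.exp_add]
    congr 2
    field_simp
    ring

/-! ### The Gaussian observation -/

theorem observationLaw_eq_pi {d m : ℕ} (θ : Mat d m) (σ : ℝ) (n : ℕ) :
    observationLaw θ σ n =
      Measure.pi fun i => Measure.pi fun j => gaussianReal (θ i j) (σ ^ 2 / n).toNNReal := by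
  have h1 : ∀ i, (Measure.pi fun _ : Fin m => gaussianReal 0 (σ ^ 2 / n).toNNReal).map
      (fun z => θ i + z) = Measure.pi fun j => gaussianReal (θ i j) (σ ^ 2 / n).toNNReal := by
    intro i
    have := Measure.pi_map_pi (μ := fun _ : Fin m => gaussianReal 0 (σ ^ 2 / n).toNNReal)
      (f := fun j z => θ i j + z) (fun j => by fun_prop)
    simp only [gaussianReal_map_const_add, zero_add] at this
    exact this
  have h2 := Measure.pi_map_pi
    (μ := fun _ : Fin d => Measure.pi fun _ : Fin m => gaussianReal 0 (σ ^ 2 / n).toNNReal)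
    (f := fun i z => θ i + z) (fun i => by fun_prop)
  simp only [h1] at h2
  exact h2

theorem hasSqDensity_observationLaw {d m : ℕ} (θ : Mat d m) {σ : ℝ} (hσ : 0 < σ) {n : ℕ}
    (hn : 1 ≤ n) :
    HasSqDensity (noiseLaw d m σ n) (observationLaw θ σ n)
      (ENNReal.ofReal (Real.exp (sqFrobenius θ / (σ ^ 2 / n)))) := by
  have hn' : (0 : ℝ) < n := by exact_mod_cast hn
  have hτ : 0 < σ ^ 2 / n := by positivity
  have hv : (σ ^ 2 / n).toNNReal ≠ 0 := by simpa using hτ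
  rw [observationLaw_eq_pi, noiseLaw]
  convert HasSqDensity.pi fun i => HasSqDensity.pi fun j =>
    hasSqDensity_gaussianReal (θ i j) hv using 1
  rw [Real.coe_toNNReal _ hτ.le, sqFrobenius, Finset.sum_div, Real.exp_sum,
    ENNReal.ofReal_prod_of_nonneg fun _ _ => by positivity]
  refine Finset.prod_congr rfl fun i _ => ?_
  rw [Finset.sum_div, Real.exp_sum, ENNReal.ofReal_prod_of_nonneg fun _ _ => by positivity]

instance {d m : ℕ} (σ : ℝ) (n : ℕ) : IsProbabilityMeasure (noiseLaw d m σ n) := by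
  unfold noiseLaw; infer_instance

instance {d m : ℕ} (θ : Mat d m) (σ : ℝ) (n : ℕ) :
    IsProbabilityMeasure (observationLaw θ σ n) := by
  rw [observationLaw_eq_pi]; infer_instance

/-! ### From testing to estimation -/

/-- Testing bound: if every `ν w` has a density with second moment at most `B` and no point lies
in more than `V` of the sets `A w`, then `ν w` misses `A w` with probability above `1 / 2` for some
`w`, because `ν w (A w) ^ 2 ≤ B * μ (A w)` and `∑ w, μ (A w) ≤ V`. -/
theorem exists_measureReal_lt_half {W Ω : Type*} [Fintype W] [MeasurableSpace Ω]
    {μ : Measure Ω} [IsProbabilityMeasure μ] {ν : W → Measure Ω} {c : W → ℝ}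
    (hν : ∀ w, HasSqDensity μ (ν w) (ENNReal.ofReal (c w))) {B V : ℝ} (hB : 0 ≤ B)
    (hc : ∀ w, c w ≤ B) {A : W → Set Ω} (hA : ∀ w, MeasurableSet (A w))
    (hV : ∀ y, ∑ w, (A w).indicator (1 : Ω → ℝ) y ≤ V)
    (hcard : 4 * (B * V) < Fintype.card W) :
    ∃ w, (ν w).real (A w) < 1 / 2 := by
  by_contra! hcon
  have h1 : ∀ w, 1 / 4 ≤ B * μ.real (A w) := fun w => by
    have h2 : (ν w).real (A w) ^ 2 ≤ B * μ.real (A w) := by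
      have h3 := (hν w).sq_measure_le (hA w)
      have h4 : ν w (A w) ^ 2 ≤ ENNReal.ofReal B * μ (A w) :=
        h3.trans (by gcongr; exact hc w)
      have h5 := ENNReal.toReal_mono (by finiteness) h4
      rwa [ENNReal.toReal_pow, ENNReal.toReal_mul, ENNReal.toReal_ofReal hB] at h5
    nlinarith [hcon w]
  have h2 : ∑ w, μ.real (A w) ≤ V := by
    have h3 : ∑ w, μ.real (A w) = ∫ y, ∑ w, (A w).indicator (1 : Ω → ℝ) y ∂μ := by
      have h4 : ∀ w, Integrable ((A w).indicator (1 : Ω → ℝ)) μ := fun w =>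
        (integrable_const (1 : ℝ)).indicator (hA w)
      rw [integral_finsetSum _ fun w _ => h4 w]
      exact Finset.sum_congr rfl fun w _ => (integral_indicator_one (hA w)).symm
    rw [h3]
    calc _ ≤ ∫ _, V ∂μ := integral_mono
          (integrable_finsetSum _ fun w _ => (integrable_const (1 : ℝ)).indicator (hA w))
          (integrable_const _) hV
      _ = V := by simp
  have h3 : ∑ _w : W, (1 / 4 : ℝ) ≤ B * V := by
    calc _ ≤ ∑ w, B * μ.real (A w) := Finset.sum_le_sum fun w _ => h1 w
      _ = B * ∑ w, μ.real (A w) := by rw [Finset.mul_sum]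
      _ ≤ _ := by gcongr
  simp at h3
  linarith

theorem measurable_sqFrobenius {d m : ℕ} : Measurable (sqFrobenius : Mat d m → ℝ) := by
  unfold sqFrobenius
  fun_prop

theorem sqFrobenius_sub_le {d m : ℕ} (A B C : Mat d m) :
    sqFrobenius (A - B) ≤ 2 * sqFrobenius (C - A) + 2 * sqFrobenius (C - B) := by
  simp only [sqFrobenius, Finset.mul_sum, ← Finset.sum_add_distrib]
  refine Finset.sum_le_sum fun i _ => Finset.sum_le_sum fun j _ => ?_
  simp only [Pi.sub_apply]
  nlinarith [sq_nonneg (2 * C i j - A i j - B i j)]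

/-- Reduction from estimation to a code: if at most `V` code words lie within squared distance
`4 * r` of any given one, each estimate is `r`-close to at most `V` of them, so a code larger
than the `χ²` radius times `V` cannot be decoded. -/
theorem minimaxRiskAtLeast_half_of_code {W : Type*} [Fintype W] {d m n : ℕ} {σ : ℝ} (hσ : 0 < σ)
    (hn : 1 ≤ n) {Θ : Set (Mat d m)} {θ : W → Mat d m} (hθ : ∀ w, θ w ∈ Θ) {E V r : ℝ}
    (hE : ∀ w, sqFrobenius (θ w) ≤ E) (hV0 : 0 ≤ V)
    (hV : ∀ w₀, ((Finset.univ.filter fun w => sqFrobenius (θ w - θ w₀) < 4 * r).card : ℝ) ≤ V)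
    (hcard : 4 * (Real.exp (E / (σ ^ 2 / n)) * V) < Fintype.card W) :
    MinimaxRiskAtLeast Θ σ n r (1 / 2) := by
  classical
  intro est hest
  have hn' : (0 : ℝ) < n := by exact_mod_cast hn
  have hloss : ∀ w, Measurable fun Y => sqFrobenius (est Y - θ w) := fun w =>
    measurable_sqFrobenius.comp (hest.sub_const _)
  have hA : ∀ w, MeasurableSet {Y | sqFrobenius (est Y - θ w) < r} := fun w =>
    measurableSet_lt (hloss w) measurable_const
  obtain ⟨w, hw⟩ := exists_measureReal_lt_half (μ := noiseLaw d m σ n)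
    (ν := fun w => observationLaw (θ w) σ n)
    (fun w => hasSqDensity_observationLaw (θ w) hσ hn) (Real.exp_pos (E / (σ ^ 2 / n))).le
    (fun w => Real.exp_le_exp.2 (by gcongr; exact hE w)) hA (V := V) (fun Y => by
      by_cases hY : ∃ w₀, sqFrobenius (est Y - θ w₀) < r
      · obtain ⟨w₀, hw₀⟩ := hY
        refine le_trans ?_ (hV w₀)
        rw [Finset.card_filter]
        push_cast
        refine Finset.sum_le_sum fun w _ => ?_
        by_cases hw : sqFrobenius (est Y - θ w) < r
        · have := sqFrobenius_sub_le (θ w) (θ w₀) (est Y)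
          have h : sqFrobenius (θ w - θ w₀) < 4 * r := by linarith
          simp [Set.indicator, hw, h]
        · simp only [Set.indicator, Set.mem_ofPred_eq, hw, if_false]
          split_ifs <;> norm_num
      · push Not at hY
        refine le_of_eq_of_le (Finset.sum_eq_zero fun w _ => ?_) hV0
        exact Set.indicator_of_notMem (by simpa using hY w) _) hcard
  refine ⟨θ w, hθ w, ?_⟩
  have h2 : {Y | r ≤ sqFrobenius (est Y - θ w)} = {Y | sqFrobenius (est Y - θ w) < r}ᶜ := by
    ext Y; simp
  rw [h2, probReal_compl_eq_one_sub (hA w)]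
  linarith

/-! ### Hamming balls -/

/-- Volume of a Hamming ball of half the block length: weigh each word `w` by `Q ^ (-dist w w₀)`;
these weights factor over the letters and sum to at most `2 ^ N`. -/
theorem card_hammingDist_le {β α : Type*} [Fintype β] [DecidableEq β] [Fintype α]
    [DecidableEq α] [Nonempty α] (w₀ : β → α) :
    ((Finset.univ.filter fun w : β → α => 2 * hammingDist w w₀ ≤ Fintype.card β).card : ℝ)
      ≤ (2 * √(Fintype.card α : ℝ)) ^ Fintype.card β := by
  set Q : ℝ := (Fintype.card α : ℝ) with hQ
  have hQ1 : 1 ≤ Q := by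
    rw [hQ]; exact_mod_cast Fintype.card_pos
  have hu : 1 ≤ √Q := by simpa using hQ1
  have hu2 : √Q ^ 2 = Q := Real.sq_sqrt (by linarith)
  have hweight : ∀ w : β → α,
      (∏ b, if w b = w₀ b then (1 : ℝ) else Q⁻¹) = (Q⁻¹) ^ hammingDist w w₀ := fun w => by
    rw [hammingDist, Finset.prod_ite]
    simp
  have hsum : ∑ w : β → α, (Q⁻¹) ^ hammingDist w w₀ ≤ 2 ^ Fintype.card β := by
    simp_rw [← hweight]
    have := Finset.sum_prod_piFinset (Finset.univ : Finset α)
      (fun (b : β) (x : α) => if x = w₀ b then (1 : ℝ) else Q⁻¹)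
    rw [Fintype.piFinset_univ] at this
    rw [this, Fintype.card, ← Finset.prod_const]
    refine Finset.prod_le_prod (fun b _ => Finset.sum_nonneg fun x _ => by positivity)
      fun b _ => ?_
    calc ∑ x : α, (if x = w₀ b then (1 : ℝ) else Q⁻¹)
        ≤ ∑ x : α, ((if x = w₀ b then (1 : ℝ) else 0) + Q⁻¹) := by
          refine Finset.sum_le_sum fun x _ => ?_
          split_ifs
          · have : 0 ≤ Q⁻¹ := by positivity
            linarith
          · simp
      _ = 2 := by
          rw [Finset.sum_add_distrib]
          have : Q ≠ 0 := by positivity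
          simp only [Finset.sum_ite_eq', Finset.mem_univ, if_true, Finset.sum_const,
            Finset.card_univ, nsmul_eq_mul, ← hQ]
          rw [mul_inv_cancel₀ this]
          norm_num
  calc ((Finset.univ.filter fun w : β → α => 2 * hammingDist w w₀ ≤ Fintype.card β).card : ℝ)
      = ∑ w : β → α, if 2 * hammingDist w w₀ ≤ Fintype.card β then (1 : ℝ) else 0 := by
        simp
    _ ≤ ∑ w : β → α, √Q ^ Fintype.card β * (Q⁻¹) ^ hammingDist w w₀ := by
        refine Finset.sum_le_sum fun w _ => ?_
        split_ifs with h
        · rw [inv_pow, ← hu2, Real.sqrt_sq (by positivity), ← pow_mul, ← div_eq_mul_inv,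
            one_le_div (by positivity)]
          exact pow_le_pow_right₀ hu h
        · positivity
    _ = √Q ^ Fintype.card β * ∑ w : β → α, (Q⁻¹) ^ hammingDist w w₀ := by
        rw [Finset.mul_sum]
    _ ≤ √Q ^ Fintype.card β * 2 ^ Fintype.card β := by gcongr
    _ = _ := by rw [mul_pow]; ring

/-! ### Block codes -/

/-- The entries of a code word inside the blocks: block `b` has a single non-zero entry, at the
position `(w b).1`, with amplitude `a * (ℓ + 1) / K` where `ℓ = (w b).2` is one of `K` levels. -/
noncomputable def codeEntry {β : Type*} {k K : ℕ} (a : ℝ) (w : β → Fin k × Fin K)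
    (p : β × Fin k) : ℝ :=
  if (w p.1).1 = p.2 then a * (((w p.1).2 : ℕ) + 1) / K else 0

/-- The matrix of a code word: block entries are placed along `pos`, all other entries vanish. -/
noncomputable def codeMatrix {β : Type*} {k K d m : ℕ} (pos : β × Fin k → Fin d × Fin m) (a : ℝ)
    (w : β → Fin k × Fin K) : Mat d m :=
  fun i j => Function.extend pos (codeEntry a w) 0 (i, j)

section code

variable {β : Type*} {k K d m : ℕ} {pos : β × Fin k → Fin d × Fin m} {a : ℝ}

theorem codeEntry_nonneg (ha : 0 ≤ a) (w : β → Fin k × Fin K) (p : β × Fin k) :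
    0 ≤ codeEntry a w p := by
  unfold codeEntry; split_ifs <;> positivity

theorem codeEntry_le (ha : 0 ≤ a) (w : β → Fin k × Fin K) (p : β × Fin k) :
    codeEntry a w p ≤ a := by
  have hK : (0 : ℝ) < K := by exact_mod_cast (w p.1).2.pos
  have hl : (((w p.1).2 : ℕ) : ℝ) + 1 ≤ K := by exact_mod_cast (w p.1).2.isLt
  unfold codeEntry
  split_ifs
  · rw [div_le_iff₀ hK]; gcongr
  · exact ha

theorem codeMatrix_apply_pos (hpos : pos.Injective) (w : β → Fin k × Fin K) (p : β × Fin k) :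
    codeMatrix pos a w (pos p).1 (pos p).2 = codeEntry a w p :=
  hpos.extend_apply _ _ _

theorem abs_codeMatrix_le (hpos : pos.Injective) (ha : 0 ≤ a) (w : β → Fin k × Fin K)
    (i : Fin d) (j : Fin m) : |codeMatrix pos a w i j| ≤ a := by
  by_cases h : ∃ p, pos p = (i, j)
  · obtain ⟨p, hp⟩ := h
    have := codeMatrix_apply_pos (a := a) hpos w p
    rw [hp] at this
    rw [this, abs_of_nonneg (codeEntry_nonneg ha w p)]
    exact codeEntry_le ha w p
  · rw [codeMatrix, Function.extend_apply' _ _ _ h]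
    simpa using ha

theorem exists_pos_of_codeMatrix_ne_zero (hpos : pos.Injective) {w : β → Fin k × Fin K}
    {i : Fin d} {j : Fin m} (h : codeMatrix pos a w i j ≠ 0) :
    ∃ b, pos (b, (w b).1) = (i, j) := by
  by_cases hp : ∃ p, pos p = (i, j)
  · obtain ⟨⟨b, x⟩, hp⟩ := hp
    have h2 := codeMatrix_apply_pos (a := a) hpos w (b, x)
    rw [hp] at h2
    rw [h2, codeEntry] at h
    have h3 : (w b).1 = x := by
      by_contra h3
      simp [h3] at h
    exact ⟨b, by rw [h3, hp]⟩
  · exact absurd (Function.extend_apply' _ _ _ hp) h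

variable [Fintype β]

theorem sqFrobenius_codeMatrix_sub (hpos : pos.Injective) (w w' : β → Fin k × Fin K) :
    sqFrobenius (codeMatrix pos a w - codeMatrix pos a w')
      = ∑ b, ∑ x, (codeEntry a w (b, x) - codeEntry a w' (b, x)) ^ 2 := by
  rw [sqFrobenius, ← Fintype.sum_prod_type', ← Fintype.sum_prod_type']
  symm
  refine Fintype.sum_of_injective pos hpos _ _ (fun e he => ?_) fun p => ?_
  · have : ¬ ∃ p, pos p = (e.1, e.2) := he
    simp [codeMatrix, Function.extend_apply' _ _ _ this]
  · simp only [Pi.sub_apply, codeMatrix_apply_pos hpos]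

theorem hammingDist_mul_le_sqFrobenius (hpos : pos.Injective) (w w' : β → Fin k × Fin K) :
    hammingDist w w' * (a / K) ^ 2
      ≤ sqFrobenius (codeMatrix pos a w - codeMatrix pos a w') := by
  classical
  rw [sqFrobenius_codeMatrix_sub hpos, hammingDist, Finset.card_filter]
  push_cast
  rw [Finset.sum_mul]
  refine Finset.sum_le_sum fun b _ => ?_
  split_ifs with h
  · refine le_trans ?_ (Finset.single_le_sum (fun x _ => sq_nonneg _)
      (Finset.mem_univ (w b).1))
    simp only [codeEntry, if_true]
    by_cases hx : (w' b).1 = (w b).1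
    · have hne : (((w b).2 : ℕ) : ℤ) - ((w' b).2 : ℕ) ≠ 0 := fun h0 => h (Prod.ext hx.symm
        (Fin.ext (by omega)))
      have h1 : (1 : ℝ) ≤ ((((w b).2 : ℕ) : ℝ) - ((w' b).2 : ℕ)) ^ 2 := by
        have : (1 : ℤ) ≤ ((((w b).2 : ℕ) : ℤ) - ((w' b).2 : ℕ)) ^ 2 := by
          have := pow_pos (abs_pos.2 hne) 2
          rw [sq_abs] at this
          omega
        exact_mod_cast this
      rw [if_pos hx]
      calc 1 * (a / K) ^ 2
          ≤ ((((w b).2 : ℕ) : ℝ) - ((w' b).2 : ℕ)) ^ 2 * (a / K) ^ 2 := by gcongr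
        _ = _ := by ring
    · rw [if_neg hx]
      have h1 : (1 : ℝ) ≤ (((w b).2 : ℕ) + 1) ^ 2 := one_le_pow₀ (by simp)
      calc 1 * (a / K) ^ 2 ≤ (((w b).2 : ℕ) + 1) ^ 2 * (a / K) ^ 2 := by gcongr
        _ = _ := by ring
  · rw [zero_mul]
    exact Finset.sum_nonneg fun x _ => sq_nonneg _

theorem sqFrobenius_codeMatrix_le (hpos : pos.Injective) (ha : 0 ≤ a)
    (w : β → Fin k × Fin K) :
    sqFrobenius (codeMatrix pos a w) ≤ Fintype.card β * a ^ 2 := by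
  have h0 : sqFrobenius (codeMatrix pos a w) = ∑ b, ∑ x, codeEntry a w (b, x) ^ 2 := by
    rw [sqFrobenius, ← Fintype.sum_prod_type', ← Fintype.sum_prod_type']
    symm
    refine Fintype.sum_of_injective pos hpos _ _ (fun e he => ?_) fun p => ?_
    · have : ¬ ∃ p, pos p = (e.1, e.2) := he
      simp [codeMatrix, Function.extend_apply' _ _ _ this]
    · simp only [codeMatrix_apply_pos hpos]
  rw [h0, Fintype.card, ← nsmul_eq_mul]
  refine Finset.sum_le_card_nsmul _ _ _ fun b _ => ?_
  rw [Finset.sum_eq_single (w b).1]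
  · have := codeEntry_nonneg ha w (b, (w b).1)
    have := codeEntry_le ha w (b, (w b).1)
    gcongr
  · intro x _ hx
    simp [codeEntry, hx.symm]
  · simp

/-- Lower bound from block codes. With `K` amplitude levels an alphabet has `Q = k * K` letters,
and the amplitude may be as large as `a² = (σ² / n) log Q / 4`; the `K` levels keep the alphabet
large even when the blocks consist of a single entry. -/
theorem minimaxRiskAtLeast_blockCode [Nonempty β] (hpos : pos.Injective) {n : ℕ} {σ : ℝ}
    (hσ : 0 < σ) (hn : 1 ≤ n) (hk : 1 ≤ k) (hK : 10000 ≤ K) (ha : 0 < a)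
    (haQ : a ^ 2 ≤ σ ^ 2 / n * (Real.log (k * K) / 4)) {Θ : Set (Mat d m)}
    (hθ : ∀ w : β → Fin k × Fin K, codeMatrix pos a w ∈ Θ) :
    MinimaxRiskAtLeast Θ σ n (Fintype.card β * a ^ 2 / (8 * K ^ 2)) (1 / 2) := by
  classical
  have hn' : (0 : ℝ) < n := by exact_mod_cast hn
  have hk' : (1 : ℝ) ≤ k := by exact_mod_cast hk
  have hK' : (10000 : ℝ) ≤ K := by exact_mod_cast hK
  have hτ : 0 < σ ^ 2 / n := by positivity
  set Q : ℝ := k * K with hQ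
  have hQ4 : 10 ^ 4 ≤ Q := by nlinarith
  set N := Fintype.card β with hN
  have hN1 : N ≠ 0 := Fintype.card_ne_zero
  set x : ℝ := √√Q with hx
  have hx2 : x ^ 2 = √Q := Real.sq_sqrt (by positivity)
  have hx4 : x ^ 4 = Q := by
    rw [show 4 = 2 * 2 from rfl, pow_mul, hx2, Real.sq_sqrt (by positivity)]
  have hx0 : 0 ≤ x := Real.sqrt_nonneg _
  have hx10 : 10 ≤ x := by
    by_contra! h
    have : x ^ 4 < 10 ^ 4 := by gcongr
    linarith
  refine minimaxRiskAtLeast_half_of_code hσ hn hθ (E := N * a ^ 2) (V := (2 * √Q) ^ N)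
    (sqFrobenius_codeMatrix_le hpos ha.le) (by positivity) (fun w₀ => ?_) ?_
  · have : Nonempty (Fin k × Fin K) := ⟨w₀ (Classical.arbitrary β)⟩
    have hcard := card_hammingDist_le w₀
    rw [Fintype.card_prod, Fintype.card_fin, Fintype.card_fin] at hcard
    push_cast at hcard
    refine le_trans ?_ hcard
    gcongr with w _
    intro hw
    have h1 := (hammingDist_mul_le_sqFrobenius (a := a) hpos w w₀).trans_lt hw
    have h2 : (0 : ℝ) < (a / K) ^ 2 := by positivity
    have h3 : 4 * (N * a ^ 2 / (8 * (K : ℝ) ^ 2)) = N / 2 * (a / K) ^ 2 := by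
      field_simp; ring
    rw [h3, mul_lt_mul_iff_left₀ h2] at h1
    have h4 : (2 : ℝ) * hammingDist w w₀ ≤ N := by linarith
    exact_mod_cast h4
  · have h1 : Real.exp (N * a ^ 2 / (σ ^ 2 / n)) ≤ x ^ N := by
      rw [mul_div_assoc, Real.exp_nat_mul]
      gcongr
      calc Real.exp (a ^ 2 / (σ ^ 2 / n)) ≤ Real.exp (Real.log Q / 4) := by
            rwa [Real.exp_le_exp, div_le_iff₀' hτ]
        _ = x := by
            rw [← hx4, Real.log_pow]
            push_cast
            rw [mul_div_cancel_left₀ _ (by norm_num), Real.exp_log (by linarith)]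
    have hcardW : (Fintype.card (β → Fin k × Fin K) : ℝ) = (x ^ 4) ^ N := by
      simp [hx4, hQ, hN]
    rw [hcardW, ← hx2]
    have h5 : (4 : ℝ) < 5 ^ N :=
      lt_of_lt_of_le (by norm_num) (le_self_pow₀ (by norm_num : (1 : ℝ) ≤ 5) hN1)
    calc 4 * (Real.exp (N * a ^ 2 / (σ ^ 2 / n)) * (2 * x ^ 2) ^ N)
        ≤ 4 * (x ^ N * (2 * x ^ 2) ^ N) := by gcongr
      _ < 5 ^ N * (x ^ N * (2 * x ^ 2) ^ N) := by gcongr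
      _ = (10 * x ^ 3) ^ N := by rw [← mul_pow, ← mul_pow]; ring
      _ ≤ (x ^ 4) ^ N := by
          gcongr
          nlinarith [pow_nonneg hx0 3]

end code

theorem MinimaxRiskAtLeast.mono {d m n : ℕ} {Θ : Set (Mat d m)} {σ r r' p p' : ℝ}
    (h : MinimaxRiskAtLeast Θ σ n r p) (hr : r' ≤ r) (hp : p' ≤ p) :
    MinimaxRiskAtLeast Θ σ n r' p' := fun est hest => by
  obtain ⟨θ, hθ, h⟩ := h est hest
  exact ⟨θ, hθ, hp.trans_lt (h.trans_le (measureReal_mono fun Y hY => hr.trans hY))⟩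

/-! ### Rates for hard sparsity -/

theorem mul_div_le_mul_natDiv {s m : ℕ} (hs : 1 ≤ s) (hsm : s ≤ m) :
    5000 * ((m : ℝ) / s) ≤ ((m / s : ℕ) : ℝ) * 10000 := by
  have hs' : (0 : ℝ) < s := by exact_mod_cast hs
  have h1 : m < s * (m / s + 1) := by
    rw [mul_comm]; exact Nat.lt_mul_of_div_lt (Nat.lt_succ_self _) hs
  have h2 : 1 ≤ m / s := (Nat.one_le_div_iff hs).2 hsm
  have h3 : (m : ℝ) ≤ s * (2 * (m / s : ℕ)) := by
    exact_mod_cast h1.le.trans (Nat.mul_le_mul_left s (by omega))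
  rw [mul_div_assoc', div_le_iff₀ hs']
  linarith

theorem log_exp_mul_div_le {s m : ℕ} (hs : 1 ≤ s) (hsm : s ≤ m) :
    Real.log (Real.exp 1 * m / s) ≤ Real.log (((m / s : ℕ) : ℝ) * (10000 : ℕ)) := by
  have hs' : (0 : ℝ) < s := by exact_mod_cast hs
  have hm' : (0 : ℝ) < m := by exact_mod_cast hs.trans hsm
  refine Real.log_le_log (by positivity) ?_
  have h1 : Real.exp 1 ≤ 5000 := Real.exp_one_lt_d9.le.trans (by norm_num)
  have h2 := mul_div_le_mul_natDiv hs hsm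
  calc Real.exp 1 * m / s = Real.exp 1 * (m / s) := by ring
    _ ≤ 5000 * (m / s) := by gcongr
    _ ≤ _ := by simpa using h2

theorem one_le_log_exp_mul_div {s m : ℕ} (hs : 1 ≤ s) (hsm : s ≤ m) :
    1 ≤ Real.log (Real.exp 1 * m / s) := by
  have hs' : (0 : ℝ) < s := by exact_mod_cast hs
  have h : (s : ℝ) ≤ m := by exact_mod_cast hsm
  rw [Real.le_log_iff_exp_le (by have := hs'.trans_le h; positivity), mul_div_assoc]
  exact le_mul_of_one_le_right (by positivity) ((one_le_div hs').2 h)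

/-- The cost of not knowing which columns are active: the column indices are cut into `s` blocks
of length `m / s`, each with a single non-zero entry in the first row. -/
theorem minimaxRiskAtLeast_columns {n m d s : ℕ} {σ a : ℝ} (hσ : 0 < σ) (hn : 1 ≤ n) (hs : 1 ≤ s)
    (hsm : s ≤ m) (hd : 1 ≤ d) (ha : 0 < a)
    (haQ : a ^ 2 ≤ σ ^ 2 / n * (Real.log (Real.exp 1 * m / s) / 4)) {Θ : Set (Mat d m)}
    (hΘ : ∀ θ ∈ Theta0 m d s 1, (∀ i j, |θ i j| ≤ a) → θ ∈ Θ) :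
    MinimaxRiskAtLeast Θ σ n (s * a ^ 2 / (8 * 10 ^ 8)) (1 / 2) := by
  classical
  let pos : Fin s × Fin (m / s) → Fin d × Fin m := fun p =>
    (⟨0, hd⟩, Fin.castLE (Nat.mul_div_le m s) (finProdFinEquiv p))
  have hpos : pos.Injective := fun p p' h => by
    have := (Prod.ext_iff.1 h).2
    exact finProdFinEquiv.injective (Fin.castLE_injective (Nat.mul_div_le m s) this)
  have : Nonempty (Fin s) := ⟨⟨0, hs⟩⟩
  have : Nonempty (Fin d) := ⟨⟨0, hd⟩⟩
  have key := minimaxRiskAtLeast_blockCode hpos hσ hn ((Nat.one_le_div_iff hs).2 hsm)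
    (le_refl 10000) ha (haQ.trans (by gcongr σ ^ 2 / n * (?_ / 4); exact log_exp_mul_div_le hs hsm))
    (Θ := Θ)
    (fun w => hΘ _ ⟨?_, fun j => ?_⟩ (abs_codeMatrix_le hpos ha.le w))
  · exact key.mono (by simp only [Fintype.card_fin]; norm_num) le_rfl
  · calc _ ≤ (Finset.univ.image fun b => (pos (b, (w b).1)).2).card := by
          refine Finset.card_le_card fun j hj => ?_
          simp only [Finset.mem_filter, Finset.mem_univ, true_and] at hj
          obtain ⟨i, hi⟩ := Function.ne_iff.1 hj
          obtain ⟨b, hb⟩ := exists_pos_of_codeMatrix_ne_zero hpos hi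
          exact Finset.mem_image.2 ⟨b, Finset.mem_univ _, by rw [hb]⟩
      _ ≤ _ := Finset.card_image_le.trans (by simp)
  · refine Finset.card_le_one_iff_subset_singleton.2 ⟨⟨0, hd⟩, fun i hi => ?_⟩
    simp only [Finset.mem_filter, Finset.mem_univ, true_and] at hi
    obtain ⟨b, hb⟩ := exists_pos_of_codeMatrix_ne_zero hpos hi
    exact Finset.mem_singleton.2 (Prod.ext_iff.1 hb).1.symm

/-- The cost of not knowing the support inside the columns: the first `s` columns are active, and
each is cut into `s₀` blocks of length `d / s₀` with a single non-zero entry. -/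
theorem minimaxRiskAtLeast_supports {n m d s s₀ : ℕ} {σ a : ℝ} (hσ : 0 < σ) (hn : 1 ≤ n)
    (hs : 1 ≤ s) (hsm : s ≤ m) (hs₀ : 1 ≤ s₀) (hsd : s₀ ≤ d) (ha : 0 < a)
    (haQ : a ^ 2 ≤ σ ^ 2 / n * (Real.log (((d / s₀ : ℕ) : ℝ) * (10000 : ℕ)) / 4))
    {Θ : Set (Mat d m)} (hΘ : ∀ θ ∈ Theta0 m d s s₀, (∀ i j, |θ i j| ≤ a) → θ ∈ Θ) :
    MinimaxRiskAtLeast Θ σ n (s * s₀ * a ^ 2 / (8 * 10 ^ 8)) (1 / 2) := by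
  classical
  let pos : (Fin s × Fin s₀) × Fin (d / s₀) → Fin d × Fin m := fun p =>
    (Fin.castLE (Nat.mul_div_le d s₀) (finProdFinEquiv (p.1.2, p.2)), Fin.castLE hsm p.1.1)
  have hpos : pos.Injective := fun p p' h => by
    obtain ⟨h1, h2⟩ := Prod.ext_iff.1 h
    have h3 := Fin.castLE_injective hsm h2
    have h4 := finProdFinEquiv.injective (Fin.castLE_injective (Nat.mul_div_le d s₀) h1)
    obtain ⟨h5, h6⟩ := Prod.ext_iff.1 h4
    exact Prod.ext (Prod.ext h3 h5) h6
  have : Nonempty (Fin s × Fin s₀) := ⟨⟨0, hs⟩, ⟨0, hs₀⟩⟩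
  have key := minimaxRiskAtLeast_blockCode hpos hσ hn ((Nat.one_le_div_iff hs₀).2 hsd)
    (le_refl 10000) ha haQ (Θ := Θ)
    (fun w => hΘ _ ⟨?_, fun j => ?_⟩ (abs_codeMatrix_le hpos ha.le w))
  · refine key.mono ?_ le_rfl
    simp only [Fintype.card_prod, Fintype.card_fin]
    push_cast
    norm_num
  · calc _ ≤ (Finset.univ.image (Fin.castLE hsm)).card := by
          refine Finset.card_le_card fun j hj => ?_
          simp only [Finset.mem_filter, Finset.mem_univ, true_and] at hj
          obtain ⟨i, hi⟩ := Function.ne_iff.1 hj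
          obtain ⟨b, hb⟩ := exists_pos_of_codeMatrix_ne_zero hpos hi
          exact Finset.mem_image.2 ⟨b.1, Finset.mem_univ _, (Prod.ext_iff.1 hb).2⟩
      _ ≤ _ := Finset.card_image_le.trans (by simp)
  · by_cases hj : ∃ j₀, Fin.castLE hsm j₀ = j
    · obtain ⟨j₀, hj₀⟩ := hj
      calc _ ≤ (Finset.univ.image fun b => (pos ((j₀, b), (w (j₀, b)).1)).1).card := by
            refine Finset.card_le_card fun i hi => ?_
            simp only [Finset.mem_filter, Finset.mem_univ, true_and] at hi
            obtain ⟨⟨b₁, b₂⟩, hb⟩ := exists_pos_of_codeMatrix_ne_zero hpos hi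
            have hb₁ : b₁ = j₀ :=
              Fin.castLE_injective hsm ((Prod.ext_iff.1 hb).2.trans hj₀.symm)
            subst hb₁
            exact Finset.mem_image.2 ⟨b₂, Finset.mem_univ _, by rw [hb]⟩
        _ ≤ _ := Finset.card_image_le.trans (by simp)
    · refine (Finset.card_eq_zero.2 (Finset.filter_eq_empty_iff.2 fun i _ hi => hj ?_)).trans_le
        (Nat.zero_le _)
      obtain ⟨b, hb⟩ := exists_pos_of_codeMatrix_ne_zero hpos hi
      exact ⟨b.1, (Prod.ext_iff.1 hb).2⟩

theorem minimaxRiskAtLeast_Theta0 {n m d s s₀ : ℕ} {σ : ℝ} (hn : 1 ≤ n) (hσ : 0 < σ)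
    (hs : 1 ≤ s) (hsm : s ≤ m) (hs₀ : 1 ≤ s₀) (hsd : s₀ ≤ d) :
    MinimaxRiskAtLeast (Theta0 m d s s₀) σ n
      (1 / (64 * 10 ^ 8) * (σ ^ 2 / n * (s * Real.log (Real.exp 1 * m / s)
        + s * s₀ * Real.log (Real.exp 1 * d / s₀)))) (1 / 2) := by
  have hn' : (0 : ℝ) < n := by exact_mod_cast hn
  have hτ : 0 < σ ^ 2 / n := by positivity
  have h1 := one_le_log_exp_mul_div hs hsm
  have h2 := one_le_log_exp_mul_div hs₀ hsd
  set τ := σ ^ 2 / n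
  set L₁ := Real.log (Real.exp 1 * m / s) with hL₁
  set L₂ := Real.log (Real.exp 1 * d / s₀) with hL₂
  have ha₁ : 0 < τ * (L₁ / 4) := by positivity
  have ha₂ : 0 < τ * (L₂ / 4) := by positivity
  have k1 := minimaxRiskAtLeast_columns (a := √(τ * (L₁ / 4))) hσ hn hs hsm (hs₀.trans hsd)
    (Real.sqrt_pos.2 ha₁) (Real.sq_sqrt ha₁.le).le (Θ := Theta0 m d s s₀)
    (fun θ h _ => ⟨h.1, fun j => (h.2 j).trans hs₀⟩)
  have k2 := minimaxRiskAtLeast_supports (a := √(τ * (L₂ / 4))) hσ hn hs hsm hs₀ hsd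
    (Real.sqrt_pos.2 ha₂)
    ((Real.sq_sqrt ha₂.le).le.trans (by gcongr; exact log_exp_mul_div_le hs₀ hsd))
    (Θ := Theta0 m d s s₀) (fun θ h _ => h)
  rw [Real.sq_sqrt ha₁.le] at k1
  rw [Real.sq_sqrt ha₂.le] at k2
  rcases le_total (τ * (s * s₀ * L₂)) (τ * (s * L₁)) with h | h
  · exact k1.mono (by linarith) le_rfl
  · exact k2.mono (by linarith) le_rfl

/-! ### Rates for soft sparsity -/

theorem mem_Thetaq_of_mem_Theta0 {m d s t : ℕ} {q a R : ℝ} (hq : 0 < q) (ha : 0 ≤ a)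
    (hR : t * a ^ q ≤ R) {θ : Mat d m} (hθ : θ ∈ Theta0 m d s t) (habs : ∀ i j, |θ i j| ≤ a) :
    θ ∈ Thetaq m d s q R := by
  refine ⟨hθ.1, fun j => le_trans ?_ hR⟩
  have hj : (Finset.univ.filter fun i => column θ j i ≠ 0).card ≤ t := hθ.2 j
  calc ∑ i, |column θ j i| ^ q
      = ∑ i ∈ Finset.univ.filter fun i => column θ j i ≠ 0, |column θ j i| ^ q := by
        symm
        refine Finset.sum_filter_of_ne fun i _ h h0 => h ?_
        rw [h0, abs_zero, Real.zero_rpow hq.ne']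
    _ ≤ (Finset.univ.filter fun i => column θ j i ≠ 0).card • a ^ q :=
        Finset.sum_le_card_nsmul _ _ _ fun i _ =>
          Real.rpow_le_rpow (abs_nonneg _) (habs i j) hq.le
    _ ≤ t * a ^ q := by rw [nsmul_eq_mul]; gcongr

theorem sqrt_rpow_le {q x R : ℝ} (hq : 0 < q) (hx : 0 ≤ x) (hR : 0 < R) (h : x ≤ R ^ (2 / q)) :
    √x ^ q ≤ R := by
  rw [Real.sqrt_eq_rpow, ← Real.rpow_mul hx]
  calc x ^ (1 / 2 * q) ≤ (R ^ (2 / q)) ^ (1 / 2 * q) := by gcongr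
    _ = R := by
      rw [← Real.rpow_mul hR.le, show 2 / q * (1 / 2 * q) = 1 by field_simp, Real.rpow_one]

theorem minimaxRiskAtLeast_Thetaq_columns {n m d s : ℕ} {σ κ q R : ℝ} (hn : 1 ≤ n) (hσ : 0 < σ)
    (hs : 1 ≤ s) (hsm : s ≤ m) (hd : 1 ≤ d) (hq : 0 < q) (hR : 0 < R) (hκ : 0 < κ) (hκ1 : κ ≤ 1)
    (h : κ * (σ ^ 2 / n * Real.log (Real.exp 1 * m / s)) ≤ R ^ (2 / q)) :
    MinimaxRiskAtLeast (Thetaq m d s q R) σ n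
      (κ / (32 * 10 ^ 8) * (σ ^ 2 / n * s * Real.log (Real.exp 1 * m / s))) (1 / 2) := by
  have hn' : (0 : ℝ) < n := by exact_mod_cast hn
  have hτ : 0 < σ ^ 2 / n := by positivity
  have h1 := one_le_log_exp_mul_div hs hsm
  set τ := σ ^ 2 / n
  set L := Real.log (Real.exp 1 * m / s)
  have hx : 0 < κ * (τ * (L / 4)) := by positivity
  have hτL : 0 < τ * L := by positivity
  have key := minimaxRiskAtLeast_columns (a := √(κ * (τ * (L / 4)))) hσ hn hs hsm hd
    (Real.sqrt_pos.2 hx)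
    ((Real.sq_sqrt hx.le).le.trans (mul_le_of_le_one_left (by positivity) hκ1))
    (Θ := Thetaq m d s q R) fun θ hθ habs =>
      mem_Thetaq_of_mem_Theta0 hq (Real.sqrt_nonneg _) (by
        rw [Nat.cast_one, one_mul]
        refine sqrt_rpow_le hq hx.le hR (le_trans ?_ h)
        gcongr
        linarith) hθ habs
  rw [Real.sq_sqrt hx.le] at key
  exact key.mono (le_of_eq (by ring)) le_rfl

theorem min_one_le_rpow {x p : ℝ} (hx : 0 < x) (hp : 0 ≤ p) (hp1 : p ≤ 1) : min 1 x ≤ x ^ p := by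
  rcases le_total 1 x with h | h
  · exact (min_le_left _ _).trans (Real.one_le_rpow h hp)
  · refine (min_le_right _ _).trans ?_
    simpa using Real.rpow_le_rpow_of_exponent_ge hx h hp1

/-- The support part over `ℓ_q`-balls. At amplitude `b = √(κ (σ² / n) log d)` the ball allows
`S = R / b ^ q` non-zero entries per column. The alphabet length `d / S ≥ c₁ d ^ δ` has logarithm
at least of order `log d`; the amplitude is a small multiple of `b` that fits this logarithm. -/
theorem minimaxRiskAtLeast_Thetaq_supports {n m d s : ℕ} {σ κ q R δ c₁ : ℝ} (hn : 1 ≤ n)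
    (hσ : 0 < σ) (hs : 1 ≤ s) (hsm : s ≤ m) (hd : 2 ≤ d) (hq : 0 < q) (hq1 : q ≤ 1) (hR : 0 < R)
    (hκ : 0 < κ) (hκ1 : κ ≤ 1) (hδ : 0 < δ) (hδ1 : δ ≤ 1) (hc₁ : 0 < c₁) (hc₁1 : c₁ ≤ 1)
    (h : κ * (σ ^ 2 / n * Real.log d) ≤ R ^ (2 / q))
    (hS : c₁ * (d : ℝ) ^ δ * (R / √(κ * (σ ^ 2 / n * Real.log d)) ^ q) ≤ d) :
    MinimaxRiskAtLeast (Thetaq m d s q R) σ n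
      (c₁ * (δ / (1 - Real.log c₁) / 4) * κ / (16 * 10 ^ 8)
        * (s * R * (σ ^ 2 / n * Real.log d) ^ (1 - q / 2))) (1 / 2) := by
  have hn' : (0 : ℝ) < n := by exact_mod_cast hn
  have hd' : (2 : ℝ) ≤ d := by exact_mod_cast hd
  have hlogd : 0 < Real.log d := Real.log_pos (by linarith)
  have hτ : 0 < σ ^ 2 / n := by positivity
  set τ := σ ^ 2 / n
  set l := Real.log d with hl
  have hb2 : 0 < κ * (τ * l) := by positivity
  set b := √(κ * (τ * l)) with hb
  have hb0 : 0 < b := Real.sqrt_pos.2 hb2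
  have hbsq : b ^ 2 = κ * (τ * l) := Real.sq_sqrt hb2.le
  have hbq : 0 < b ^ q := Real.rpow_pos_of_pos hb0 q
  have hbR : b ^ q ≤ R := sqrt_rpow_le hq hb2.le hR h
  set S := R / b ^ q with hSdef
  have hS1 : 1 ≤ S := (one_le_div hbq).2 hbR
  have hdδ : 1 ≤ (d : ℝ) ^ δ := Real.one_le_rpow (by linarith) hδ.le
  have hlc : Real.log c₁ ≤ 0 := Real.log_nonpos hc₁.le hc₁1
  set t := 1 / (1 - Real.log c₁) with ht
  have ht0 : 0 < t := by rw [ht]; exact one_div_pos.2 (by linarith)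
  have ht1 : t ≤ 1 := by rw [ht]; exact (div_le_one (by linarith)).2 (by linarith)
  have htc : -1 ≤ t * Real.log c₁ := by
    rw [ht, one_div, inv_mul_eq_div, le_div_iff₀ (by linarith)]
    linarith
  set c := δ / (1 - Real.log c₁) / 4 with hc
  have hct : c = t * δ / 4 := by rw [hc, ht]; ring
  have hc0 : 0 < c := by rw [hct]; positivity
  have hc1 : c ≤ 1 := by
    rw [hct]
    have := mul_le_one₀ ht1 hδ.le hδ1
    linarith
  -- The cap at `d` only matters for `d` below a constant, since `S ≤ d / c₁`.
  set s₀ := min d ⌊S⌋₊ with hs₀def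
  have hfl : 1 ≤ ⌊S⌋₊ := Nat.one_le_floor_iff _ |>.2 hS1
  have hs₀ : 1 ≤ s₀ := le_min (by omega) hfl
  have hs₀d : s₀ ≤ d := min_le_left _ _
  have hs₀' : (0 : ℝ) < s₀ := by exact_mod_cast hs₀
  have hs₀S : (s₀ : ℝ) ≤ S :=
    le_trans (by exact_mod_cast min_le_right d ⌊S⌋₊) (Nat.floor_le (by linarith))
  have hs₀low : c₁ / 2 * S ≤ s₀ := by
    rcases min_choice d ⌊S⌋₊ with hm | hm
    · rw [hs₀def, hm]
      have : c₁ * 1 * S ≤ d := le_trans (by gcongr) hS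
      nlinarith
    · rw [hs₀def, hm]
      have h1 := Nat.lt_floor_add_one S
      have h2 : (1 : ℝ) ≤ ⌊S⌋₊ := by exact_mod_cast hfl
      nlinarith
  -- Two bounds for `d / s₀`, by `1` and by `c₁ d ^ δ`, are combined with weight `t`: the factor
  -- `c₁ ^ t` is at least `exp (-1)` and is absorbed by the number of amplitude levels.
  have hlog : 4 * c * l ≤ Real.log (((d / s₀ : ℕ) : ℝ) * (10000 : ℕ)) := by
    have hr1 : 1 ≤ (d : ℝ) / s₀ := (one_le_div hs₀').2 (by exact_mod_cast hs₀d)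
    have hr2 : c₁ * (d : ℝ) ^ δ ≤ d / s₀ := by
      rw [le_div_iff₀ hs₀']
      exact le_trans (by gcongr) hS
    have hl1 : 0 ≤ Real.log ((d : ℝ) / s₀) := Real.log_nonneg hr1
    have hl2 : Real.log c₁ + δ * l ≤ Real.log ((d : ℝ) / s₀) := by
      rw [hl, ← Real.log_rpow (by linarith), ← Real.log_mul (by positivity) (by positivity)]
      exact Real.log_le_log (by positivity) hr2
    have hl3 : t * (Real.log c₁ + δ * l) ≤ Real.log ((d : ℝ) / s₀) :=
      (mul_le_mul_of_nonneg_left hl2 ht0.le).trans (mul_le_of_le_one_left hl1 ht1)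
    have hl4 : 1 ≤ Real.log 5000 := by
      rw [Real.le_log_iff_exp_le (by norm_num)]
      exact Real.exp_one_lt_d9.le.trans (by norm_num)
    have hl5 : Real.log (5000 * ((d : ℝ) / s₀)) ≤ Real.log (((d / s₀ : ℕ) : ℝ) * (10000 : ℕ)) :=
      Real.log_le_log (by positivity) (by simpa using mul_div_le_mul_natDiv hs₀ hs₀d)
    rw [Real.log_mul (by norm_num) (by positivity)] at hl5
    rw [hct]
    linarith
  have ha2 : 0 < c * b ^ 2 := by positivity
  have key := minimaxRiskAtLeast_supports (a := √(c * b ^ 2)) hσ hn hs hsm hs₀ hs₀d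
    (Real.sqrt_pos.2 ha2) (by
      rw [Real.sq_sqrt ha2.le, hbsq]
      calc c * (κ * (τ * l)) = κ * (τ * (4 * c * l / 4)) := by ring
        _ ≤ 1 * (τ * (4 * c * l / 4)) := by gcongr
        _ ≤ _ := by rw [one_mul]; gcongr)
    (Θ := Thetaq m d s q R) fun θ hθ habs =>
      mem_Thetaq_of_mem_Theta0 hq (Real.sqrt_nonneg _) (by
        calc (s₀ : ℝ) * √(c * b ^ 2) ^ q ≤ S * b ^ q := by
              gcongr
              rw [Real.sqrt_le_left hb0.le]
              exact mul_le_of_le_one_left (by positivity) hc1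
          _ = R := by rw [hSdef]; field_simp) hθ habs
  refine key.mono ?_ le_rfl
  have hSb : R * (κ * (τ * l) ^ (1 - q / 2)) ≤ S * b ^ 2 := by
    have h1 : b ^ q = (κ * (τ * l)) ^ (q / 2) := by
      rw [hb, Real.sqrt_eq_rpow, ← Real.rpow_mul hb2.le]
      ring_nf
    have h2 : S * b ^ 2 = R * (κ * (τ * l)) ^ (1 - q / 2) := by
      rw [hSdef, hbsq, h1, Real.rpow_sub hb2, Real.rpow_one]
      ring
    rw [h2, Real.mul_rpow hκ.le (by positivity)]
    gcongr
    calc κ = min 1 κ := (min_eq_right hκ1).symm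
      _ ≤ _ := min_one_le_rpow hκ (by linarith) (by linarith)
  rw [Real.sq_sqrt ha2.le]
  calc c₁ * c * κ / (16 * 10 ^ 8) * (s * R * (τ * l) ^ (1 - q / 2))
      = c₁ / 2 * (s * c * (R * (κ * (τ * l) ^ (1 - q / 2)))) / (8 * 10 ^ 8) := by ring
    _ ≤ c₁ / 2 * (s * c * (S * b ^ 2)) / (8 * 10 ^ 8) := by gcongr
    _ = s * (c₁ / 2 * S) * (c * b ^ 2) / (8 * 10 ^ 8) := by ring
    _ ≤ s * s₀ * (c * b ^ 2) / (8 * 10 ^ 8) := by gcongr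

/-- The constant of the soft sparsity rate. The dimension condition turns into `c₁ d ^ δ S ≤ d` with
`S = R / b ^ q`, because `n ^ (q / 2) b ^ q = (κ σ² log d) ^ (q / 2)` is bounded below when
`σ ≥ σ₀` and `d ≥ 2`; for `d = 1` the second term of the rate vanishes. -/
theorem exists_minimaxRiskAtLeast_Thetaq {δ C₁ κ σ₀ : ℝ} (hδ : 0 < δ) (hδ1 : δ < 1) (hC₁ : 0 < C₁)
    (hκ : 0 < κ) (hσ₀ : 0 < σ₀) :
    ∃ C : ℝ, 0 < C ∧
      ∀ (q : ℝ) (n m d s : ℕ) (R σ : ℝ), 0 < q → q ≤ 1 → 1 ≤ n → σ₀ ≤ σ → 1 ≤ s → s ≤ m →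
        1 ≤ d → 0 < R →
        C₁ * (d : ℝ) ^ δ ≤ d / (R * (n : ℝ) ^ (q / 2)) →
        κ * (σ ^ 2 / n * Real.log d) ≤ R ^ (2 / q) →
        κ * (σ ^ 2 / n * Real.log (Real.exp 1 * m / s)) ≤ R ^ (2 / q) →
        MinimaxRiskAtLeast (Thetaq m d s q R) σ n
          (C * (σ ^ 2 / n * s * Real.log (Real.exp 1 * m / s)
            + s * R * (σ ^ 2 / n * Real.log d) ^ (1 - q / 2)))
          (1 / 2) := by
  set κ' := min 1 κ with hκ'
  have hκ0 : 0 < κ' := lt_min one_pos hκ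
  have hκ1 : κ' ≤ 1 := min_le_left _ _
  have hκκ : κ' ≤ κ := min_le_right _ _
  have hlog2 : 0 < Real.log 2 := Real.log_pos one_lt_two
  set e := κ' * (σ₀ ^ 2 * Real.log 2) with he
  have he0 : 0 < e := by positivity
  set c₁ := min 1 (C₁ * min 1 e) with hc₁def
  have hc₁ : 0 < c₁ := lt_min one_pos (mul_pos hC₁ (lt_min one_pos he0))
  have hc₁1 : c₁ ≤ 1 := min_le_left _ _
  have hlc : Real.log c₁ ≤ 0 := Real.log_nonpos hc₁.le hc₁1
  set c := δ / (1 - Real.log c₁) / 4 with hc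
  have hc0 : 0 < c := by
    have : 0 < 1 - Real.log c₁ := by linarith
    positivity
  have hc1 : c ≤ 1 := by
    have : δ / (1 - Real.log c₁) ≤ 1 := (div_le_one (by linarith)).2 (by linarith)
    linarith
  have hcc : c₁ * c ≤ 1 := mul_le_one₀ hc₁1 hc0.le hc1
  refine ⟨c₁ * c * κ' / (64 * 10 ^ 8), by positivity, ?_⟩
  intro q n m d s R σ hq hq1 hn hσ hs hsm hd hR hdim hRd hRm
  have hσ0 : 0 < σ := hσ₀.trans_le hσ
  have hn' : (0 : ℝ) < n := by exact_mod_cast hn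
  have hs' : (0 : ℝ) < s := by exact_mod_cast hs
  have hd' : (1 : ℝ) ≤ d := by exact_mod_cast hd
  have hτ : 0 < σ ^ 2 / n := by positivity
  have hl : 0 ≤ Real.log d := Real.log_nonneg hd'
  have hL := one_le_log_exp_mul_div hs hsm
  have hX₁ : 0 < σ ^ 2 / n * s * Real.log (Real.exp 1 * m / s) := by positivity
  have hX₂ : 0 ≤ s * R * (σ ^ 2 / n * Real.log d) ^ (1 - q / 2) := by positivity
  set X₁ := σ ^ 2 / n * s * Real.log (Real.exp 1 * m / s)
  rcases le_or_gt (s * R * (σ ^ 2 / n * Real.log d) ^ (1 - q / 2)) X₁ with hX | hX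
  · refine (minimaxRiskAtLeast_Thetaq_columns hn hσ0 hs hsm hd hq hR hκ0 hκ1
      (le_trans (by gcongr) hRm)).mono ?_ le_rfl
    calc _ ≤ c₁ * c * κ' / (64 * 10 ^ 8) * (X₁ + X₁) := by gcongr
      _ = c₁ * c * (κ' / (32 * 10 ^ 8) * X₁) := by ring
      _ ≤ _ := mul_le_of_le_one_left (by positivity) hcc
  · have hd2 : 2 ≤ d := by
      by_contra! hlt
      have h1 : d = 1 := by omega
      rw [h1, Nat.cast_one, Real.log_one, mul_zero, Real.zero_rpow (by linarith), mul_zero] at hX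
      linarith
    have hd2' : (2 : ℝ) ≤ d := by exact_mod_cast hd2
    have hl0 : 0 < Real.log d := Real.log_pos (by linarith)
    refine (minimaxRiskAtLeast_Thetaq_supports hn hσ0 hs hsm hd2 hq hq1 hR hκ0 hκ1 hδ hδ1.le hc₁
      hc₁1 (le_trans (by gcongr) hRd) ?_).mono ?_ le_rfl
    · have hb2 : 0 < κ' * (σ ^ 2 / n * Real.log d) := by positivity
      have hb : √(κ' * (σ ^ 2 / n * Real.log d)) ^ q
          = (κ' * (σ ^ 2 / n * Real.log d)) ^ (q / 2) := by
        rw [Real.sqrt_eq_rpow, ← Real.rpow_mul hb2.le]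
        ring_nf
      have hbq : 0 < (κ' * (σ ^ 2 / n * Real.log d)) ^ (q / 2) := Real.rpow_pos_of_pos hb2 _
      have hnq : 0 < (n : ℝ) ^ (q / 2) := Real.rpow_pos_of_pos hn' _
      have hmin : min 1 e
          ≤ (n : ℝ) ^ (q / 2) * (κ' * (σ ^ 2 / n * Real.log d)) ^ (q / 2) := by
        rw [← Real.mul_rpow hn'.le hb2.le]
        refine (min_one_le_rpow he0 (p := q / 2) (by linarith) (by linarith)).trans ?_
        refine Real.rpow_le_rpow he0.le ?_ (by linarith)
        have h1 : n * (κ' * (σ ^ 2 / n * Real.log d)) = κ' * (σ ^ 2 * Real.log d) := by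
          field_simp
        rw [h1, he]
        gcongr
      rw [hb, mul_div_assoc', div_le_iff₀ hbq]
      rw [le_div_iff₀ (by positivity)] at hdim
      set B := (κ' * (σ ^ 2 / n * Real.log d)) ^ (q / 2)
      calc c₁ * (d : ℝ) ^ δ * R ≤ C₁ * ((n : ℝ) ^ (q / 2) * B) * (d : ℝ) ^ δ * R := by
            gcongr
            exact (min_le_right _ _).trans (by gcongr)
        _ = C₁ * (d : ℝ) ^ δ * (R * (n : ℝ) ^ (q / 2)) * B := by ring
        _ ≤ d * B := by gcongr
    · set X₂ := s * R * (σ ^ 2 / n * Real.log d) ^ (1 - q / 2)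
      have h0 : 0 ≤ c₁ * c * κ' / (64 * 10 ^ 8) := by positivity
      calc c₁ * c * κ' / (64 * 10 ^ 8) * (X₁ + X₂)
          ≤ c₁ * c * κ' / (64 * 10 ^ 8) * (4 * X₂) := by gcongr; linarith
        _ = _ := by ring

theorem theorem1 :
    -- (a) the case `q = 0`
    (∃ C : ℝ, 0 < C ∧
      ∀ (n m d s s₀ : ℕ) (σ : ℝ), 1 ≤ n → 0 < σ → 1 ≤ s → s ≤ m → 1 ≤ s₀ → s₀ ≤ d →
        MinimaxRiskAtLeast (Theta0 m d s s₀) σ n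
          (C * (σ ^ 2 / n * (s * Real.log (Real.exp 1 * m / s)
            + s * s₀ * Real.log (Real.exp 1 * d / s₀))))
          (1 / 2)) ∧
    -- (b) the case `0 < q ≤ 1`
    (∀ (δ C₁ κ σ₀ : ℝ), 0 < δ → δ < 1 → 0 < C₁ → 0 < κ → 0 < σ₀ →
      ∃ C : ℝ, 0 < C ∧
        ∀ (q : ℝ) (n m d s : ℕ) (R σ : ℝ), 0 < q → q ≤ 1 → 1 ≤ n → σ₀ ≤ σ → 1 ≤ s → s ≤ m →
          1 ≤ d → 0 < R →
          C₁ * (d : ℝ) ^ δ ≤ d / (R * (n : ℝ) ^ (q / 2)) →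
          κ * (σ ^ 2 / n * Real.log d) ≤ R ^ (2 / q) →
          κ * (σ ^ 2 / n * Real.log (Real.exp 1 * m / s)) ≤ R ^ (2 / q) →
          MinimaxRiskAtLeast (Thetaq m d s q R) σ n
            (C * (σ ^ 2 / n * s * Real.log (Real.exp 1 * m / s)
              + s * R * (σ ^ 2 / n * Real.log d) ^ (1 - q / 2)))
            (3 / 8)) := by
  refine ⟨⟨1 / (64 * 10 ^ 8), by norm_num, fun n m d s s₀ σ hn hσ hs hsm hs₀ hsd =>
    minimaxRiskAtLeast_Theta0 hn hσ hs hsm hs₀ hsd⟩, fun δ C₁ κ σ₀ hδ hδ1 hC₁ hκ hσ₀ => ?_⟩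
  obtain ⟨C, hC, h⟩ := exists_minimaxRiskAtLeast_Thetaq hδ hδ1 hC₁ hκ hσ₀
  exact ⟨C, hC, fun q n m d s R σ h1 h2 h3 h4 h5 h6 h7 h8 h9 h10 h11 =>
    (h q n m d s R σ h1 h2 h3 h4 h5 h6 h7 h8 h9 h10 h11).mono le_rfl (by norm_num)⟩
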